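/- **Setting.** In an $(L,K,M,N)$ MIR (multi-user information retrieval) system, $K$ single-antenna users communicate through a base station (BS) with $L$ antennas that has no access to the library of $N$ files; each user can store the equivalent of at most $M$ files. An $F$-division coded caching scheme splits each file into $F$ packets $W_{n,f}$ (encoded as complex vectors; noise is neglected). Before the demands are known, each user stores at most $MF$ packets. For a demand vector $(d_1,\dots,d_K)\in[N]^K$ there are $S_{UL}$ uplink and $S_{DL}$ downlink transmissions. In each uplink transmission every user sends a complex linear combination of packets of requested files that it has stored, and the BS receives these signals through an $L\times K$ channel matrix; in each downlink transmission the BS antennas send complex linear combinations of all signals received by the BS, and the users receive them through a $K\times L$ channel matrix. For every demand vector and all channel matrices in general position (every $L\times L$ submatrix invertible), each user $k$ must recover file $d_k$ from its cache and its received signals. If a packet of $B$ bits is sent as $\tilde B$ symbols with $B/\tilde B=\log P+o(\log P)$ at power $P$, the normalized delivery time (NDT) of $S$ transmissions is $\lim_{P\to\infty}\lim_{B\to\infty}\frac{S\tilde B}{BF/\log P}$ $(=S/F)$. The sum-DoF is the number of requested packets not stored by the users requesting them, divided by the number of transmissions. **Theorem.** Let $K,t,L,N$ be positive integers with $t+L\le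 K$ and $L\le t$, and let $M$ be the real number with $t=KM/N$. There are $F$-division $(L,K,M,N)$ MIR coded caching schemes with $\tau_{UL}=\tau_{DL}=\frac{K(1-M/N)}{t+L}$ and, for every demand vector, sum-DoF $t+L$ in both uplink and downlink, for each of the following subpacketizations $F$: 1. $F=\beta\binom{K/m}{t/m}$, for every positive integer $m$ with $m\mid K$, $m\mid t$ and $m\le L$, provided $t+L<K$. Here $l=\frac{m}{\gcd(m,L-m)}$, $\beta=\left(\mathrm{sgn}\left(\frac tm+1,\frac mL\right)+\frac{L-m}{m}\right)l$, with $\mathrm{sgn}(x,y)=1$ if $y=1$ and $\mathrm{sgn}(x,y)=x$ otherwise; in particular $F$ is an integer. 2. $F=\frac{t+L}{\alpha}\binom{K/\alpha}{(t+L)/\alpha}$, where $\alpha=\gcd(K,t,L)$. 3. $F=K$, provided $L=K-t$. -/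

import Mathlib

open Filter Topology Asymptotics

namespace MIR

/-- A state of the channel during a delivery phase with `SUL` uplink and `SDL` downlink
transmissions: `up s` is the `L × K` matrix from the `K` single-antenna users to the `L` antennas
of the base station in uplink transmission `s`, and `down s'` is the `K × L` matrix from the base
station to the users in downlink transmission `s'`. The two are not tied to each other;
`down s' = (up s')ᴴ` (a reciprocal channel) is one possibility. -/
structure Channel (L K SUL SDL : ℕ) where
  up : Fin SUL → Matrix (Fin L) (Fin K) ℂ
  down : Fin SDL → Matrix (Fin K) (Fin L) ℂ

/-- Every `L × L` submatrix of every channel matrix is invertible. -/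
def Channel.GeneralPosition {L K SUL SDL : ℕ} (c : Channel L K SUL SDL) : Prop :=
  (∀ (s : Fin SUL) (g : Fin L ↪ Fin K), ((c.up s).submatrix id g).det ≠ 0) ∧
  (∀ (s' : Fin SDL) (g : Fin L ↪ Fin K), ((c.down s').submatrix g id).det ≠ 0)

/-- The channel whose uplink coefficients are `h (s, l, k)` and whose downlink matrices are the
conjugate transposes of the uplink matrices. -/
def Channel.reciprocal {L K S : ℕ} (h : Fin S × Fin L × Fin K → ℂ) : Channel L K S S where
  up s := Matrix.of fun l k => h (s, l, k)
  down s := (Matrix.of fun l k => h (s, l, k)).conjTranspose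

/-- A nonzero polynomial is nonzero almost everywhere for a product of atomless measures. -/
theorem ae_eval_ne_zero (μ : MeasureTheory.Measure ℂ) [MeasureTheory.IsProbabilityMeasure μ]
    [MeasureTheory.NullSingletonClass μ] : ∀ (n : ℕ) (p : MvPolynomial (Fin n) ℂ), p ≠ 0 →
    ∀ᵐ x ∂(MeasureTheory.Measure.pi fun _ : Fin n => μ), MvPolynomial.eval x p ≠ 0 := by
  intro n
  induction n with
  | zero =>
    intro p hp
    refine Eventually.of_forall fun x => ?_
    rw [MvPolynomial.eq_C_of_isEmpty p, MvPolynomial.eval_C]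
    intro h0
    apply hp
    rw [MvPolynomial.eq_C_of_isEmpty p, h0, map_zero]
  | succ n ih =>
    intro p hp
    have hq : MvPolynomial.finSuccEquiv ℂ n p ≠ 0 := by
      simpa using hp
    have hlead : (MvPolynomial.finSuccEquiv ℂ n p).leadingCoeff ≠ 0 :=
      Polynomial.leadingCoeff_ne_zero.mpr hq
    have h1 := ih _ hlead
    have mp := MeasureTheory.measurePreserving_piFinSuccAbove (fun _ : Fin (n + 1) => μ) 0
    have hmeas : MeasurableSet {z : ℂ × (Fin n → ℂ) |
        MvPolynomial.eval (Fin.cons z.1 z.2 : Fin (n + 1) → ℂ) p ≠ 0} := by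
      have hc : Continuous fun z : ℂ × (Fin n → ℂ) =>
          MvPolynomial.eval (Fin.cons z.1 z.2 : Fin (n + 1) → ℂ) p := by
        refine (MvPolynomial.continuous_eval p).comp ?_
        refine continuous_pi fun i => ?_
        refine Fin.cases ?_ (fun j => ?_) i
        · simpa using continuous_fst
        · change Continuous fun z : ℂ × (Fin n → ℂ) => z.2 j
          fun_prop
      exact (isOpen_ne.preimage hc).measurableSet
    have key : ∀ᵐ z ∂(μ.prod (MeasureTheory.Measure.pi fun _ : Fin n => μ)),
        MvPolynomial.eval (Fin.cons z.1 z.2 : Fin (n + 1) → ℂ) p ≠ 0 := by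
      have hswap : ∀ᵐ w ∂((MeasureTheory.Measure.pi fun _ : Fin n => μ).prod μ),
          MvPolynomial.eval (Fin.cons w.2 w.1 : Fin (n + 1) → ℂ) p ≠ 0 := by
        refine (MeasureTheory.Measure.ae_prod_iff_ae_ae
          (hmeas.preimage measurable_swap)).mpr ?_
        filter_upwards [h1] with x hx
        have hr : Polynomial.map (MvPolynomial.eval x) (MvPolynomial.finSuccEquiv ℂ n p) ≠ 0 := by
          intro h0
          apply hx
          have := congrArg (fun r => Polynomial.coeff r
            (MvPolynomial.finSuccEquiv ℂ n p).natDegree) h0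
          simpa [Polynomial.coeff_map] using this
        have hfin : ({y : ℂ | (Polynomial.map (MvPolynomial.eval x)
            (MvPolynomial.finSuccEquiv ℂ n p)).IsRoot y}).Finite :=
          Polynomial.finite_setOfPred_isRoot hr
        have := hfin.measure_zero μ
        rw [MeasureTheory.ae_iff]
        simpa [MvPolynomial.eval_eq_eval_mv_eval'] using this
      have := MeasureTheory.Measure.measurePreserving_swap
        (μ := μ) (ν := MeasureTheory.Measure.pi fun _ : Fin n => μ)
      exact this.quasiMeasurePreserving.ae hswap
    have := mp.quasiMeasurePreserving.ae key
    filter_upwards [this] with x hx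
    have e : (Fin.cons (x 0) (fun j => x (Fin.succ j)) : Fin (n + 1) → ℂ) = x :=
      Fin.cons_self_tail x
    have e2 : (MeasurableEquiv.piFinSuccAbove (fun _ : Fin (n + 1) => ℂ) 0) x
      = (x 0, fun j => x (Fin.succ j)) := rfl
    rw [e2] at hx
    simpa [e] using hx

/-- The same for an arbitrary finite set of variables. -/
theorem ae_eval_ne_zero' {σ : Type} [Fintype σ] (μ : MeasureTheory.Measure ℂ)
    [MeasureTheory.IsProbabilityMeasure μ] [MeasureTheory.NullSingletonClass μ]
    (p : MvPolynomial σ ℂ) (hp : p ≠ 0) :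
    ∀ᵐ x ∂(MeasureTheory.Measure.pi fun _ : σ => μ), MvPolynomial.eval x p ≠ 0 := by
  classical
  let e := Fintype.equivFin σ
  have h := ae_eval_ne_zero μ (Fintype.card σ) (MvPolynomial.rename e p)
    (fun h0 => hp ((MvPolynomial.rename_injective e e.injective) (by simpa using h0)))
  have mp := MeasureTheory.measurePreserving_piCongrLeft
    (fun _ : Fin (Fintype.card σ) => μ) e
  have := mp.quasiMeasurePreserving.ae h
  filter_upwards [this] with x hx
  rw [MvPolynomial.eval_rename] at hx
  convert hx using 3
  funext i
  exact (MeasurableEquiv.piCongrLeft_apply_apply (β := fun _ => ℂ) e x i).symm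

/-- Channel coefficients that are independent with a common atomless law are almost surely in
general position. -/
theorem Channel.ae_generalPosition (L K S : ℕ) (μ : MeasureTheory.Measure ℂ)
    [MeasureTheory.IsProbabilityMeasure μ] [MeasureTheory.NullSingletonClass μ] :
    ∀ᵐ h ∂(MeasureTheory.Measure.pi fun _ : Fin S × Fin L × Fin K => μ),
      (Channel.reciprocal h).GeneralPosition := by
  have key : ∀ᵐ h ∂(MeasureTheory.Measure.pi fun _ : Fin S × Fin L × Fin K => μ),
      ∀ (s : Fin S) (g : Fin L ↪ Fin K),
        (((Channel.reciprocal h).up s).submatrix id g).det ≠ 0 := by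
    rw [MeasureTheory.ae_all_iff]; intro s
    rw [MeasureTheory.ae_all_iff]; intro g
    let f : Fin L × Fin L → Fin S × Fin L × Fin K := fun a => (s, a.1, g a.2)
    have hf : Function.Injective f := by
      rintro ⟨a, b⟩ ⟨a', b'⟩ h
      simp only [f, Prod.mk.injEq, true_and] at h
      exact Prod.ext h.1 (g.injective h.2)
    have hne := Matrix.det_mvPolynomialX_ne_zero (Fin L) ℂ
    have h := ae_eval_ne_zero' μ (MvPolynomial.rename f
        (Matrix.det (Matrix.mvPolynomialX (Fin L) (Fin L) ℂ)))
      (fun h0 => hne ((MvPolynomial.rename_injective f hf) (by simpa using h0)))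
    filter_upwards [h] with x hx
    rw [MvPolynomial.eval_rename, RingHom.map_det] at hx
    convert hx using 2
    ext i j
    simp [Channel.reciprocal, f, Matrix.mvPolynomialX]
  filter_upwards [key] with h hh
  refine ⟨hh, fun s g => ?_⟩
  have : ((Channel.reciprocal h).down s).submatrix g id
      = (((Channel.reciprocal h).up s).submatrix id g).conjTranspose := rfl
  rw [this, Matrix.det_conjTranspose]
  simpa using hh s g

/-- The content of a library: `N` files of `F` packets each, every packet being a vector of `b`
complex symbols. -/
abbrev Library (N F b : ℕ) := Fin N → Fin F → Fin b → ℂ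

/-- The data of a coded caching scheme with uncoded placement for `K` users, a base station with
`L` antennas, `N` files, `F` packets per file, `SUL` uplink and `SDL` downlink transmissions. The
caches are filled before the demands `d` and the channel state are known. -/
structure SchemeData (L K N F SUL SDL : ℕ) where
  /-- the packets `(n, f)` that user `k` stores -/
  cache : Fin K → Finset (Fin N × Fin F)
  /-- `V d c s k (n, f)`: coefficient of packet `(n, f)` in the signal of user `k` in uplink
  transmission `s` -/
  V : (Fin K → Fin N) → Channel L K SUL SDL → Fin SUL → Matrix (Fin K) (Fin N × Fin F) ℂ
  /-- `U d c s' l (s, l')`: coefficient of the signal received at antenna `l'` in uplink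
  transmission `s` in the signal sent by antenna `l` in downlink transmission `s'` -/
  U : (Fin K → Fin N) → Channel L K SUL SDL → Fin SDL → Matrix (Fin L) (Fin SUL × Fin L) ℂ

namespace SchemeData

variable {L K N F SUL SDL : ℕ} (A : SchemeData L K N F SUL SDL)

/-- The signal of user `k` in uplink transmission `s`. -/
def userSignal (d : Fin K → Fin N) (c : Channel L K SUL SDL) {b : ℕ} (W : Library N F b)
    (s : Fin SUL) (k : Fin K) : Fin b → ℂ :=
  ∑ p : Fin N × Fin F, A.V d c s k p • W p.1 p.2

/-- The signal that antenna `l` of the base station receives in uplink transmission `s`. -/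
def baseReceived (d : Fin K → Fin N) (c : Channel L K SUL SDL) {b : ℕ} (W : Library N F b)
    (s : Fin SUL) (l : Fin L) : Fin b → ℂ :=
  ∑ k : Fin K, c.up s l k • A.userSignal d c W s k

/-- The signal that antenna `l` of the base station sends in downlink transmission `s'`. -/
def baseSignal (d : Fin K → Fin N) (c : Channel L K SUL SDL) {b : ℕ} (W : Library N F b)
    (s' : Fin SDL) (l : Fin L) : Fin b → ℂ :=
  ∑ q : Fin SUL × Fin L, A.U d c s' l q • A.baseReceived d c W q.1 q.2

/-- The signal that user `k` receives in downlink transmission `s'`. -/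
def userReceived (d : Fin K → Fin N) (c : Channel L K SUL SDL) {b : ℕ} (W : Library N F b)
    (k : Fin K) (s' : Fin SDL) : Fin b → ℂ :=
  ∑ l : Fin L, c.down s' k l • A.baseSignal d c W s' l

/-- The content of the cache of user `k`. -/
def cached {b : ℕ} (W : Library N F b) (k : Fin K) : A.cache k → Fin b → ℂ :=
  fun p => W p.1.1 p.1.2

/-- `A` is an `F`-division `(L, K, M, N)` MIR coded caching scheme: each user stores at most `M F`
packets, transmits linear combinations of packets of requested files that it stores, and recovers
the file it requested from its cache and the signals it receives. -/
structure IsMIRScheme (M : ℝ) : Prop where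
  cache_le : ∀ k, ((A.cache k).card : ℝ) ≤ M * F
  up_support : ∀ d c s k p, A.V d c s k p ≠ 0 → p ∈ A.cache k ∧ p.1 ∈ Set.range d
  decodes : ∀ (d : Fin K → Fin N) (c : Channel L K SUL SDL), c.GeneralPosition →
    ∀ (b : ℕ) (k : Fin K),
      ∃ D : (A.cache k → Fin b → ℂ) → (Fin SDL → Fin b → ℂ) → (Fin F → Fin b → ℂ),
        ∀ W : Library N F b, D (A.cached W k) (A.userReceived d c W k) = W (d k)

/-- The number of requested packets that are not already stored by the users requesting them. -/
def missing (d : Fin K → Fin N) : ℕ :=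
  ∑ k : Fin K, (Finset.univ.filter fun f : Fin F => (d k, f) ∉ A.cache k).card

end SchemeData

/-- `τ` is the normalized delivery time of `S` transmissions when each file has `F` packets:
a packet of `B` bits is sent in one transmission as `B / rate P` symbols, where `P` is the power
and `rate P = log P + o(log P)`; the total number `T` of symbols is divided by `V / log P`, with
`V = B F` the file size, and `V → ∞`, then `P → ∞`. -/
def HasNDT (S F : ℕ) (τ : ℝ) : Prop :=
  ∀ rate : ℝ → ℝ, (fun P => rate P - Real.log P) =o[atTop] Real.log →
    ∃ g : ℝ → ℝ,
      (∀ᶠ P in atTop, Tendsto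
        (fun B : ℕ => ((S : ℝ) * ((B : ℝ) / rate P)) / (((B : ℝ) * F) / Real.log P))
        atTop (𝓝 (g P))) ∧
      Tendsto g atTop (𝓝 τ)

/-- There is an `F`-division `(L, K, M, N)` MIR coded caching scheme with normalized delivery time
`τ` in the uplink and in the downlink and with sum-DoF `δ` (delivered packets per transmission),
whatever the demands, in the uplink and in the downlink. -/
def Achievable (L K N F : ℕ) (M τ δ : ℝ) : Prop :=
  ∃ (SUL SDL : ℕ) (A : SchemeData L K N F SUL SDL), A.IsMIRScheme M ∧
    HasNDT SUL F τ ∧ HasNDT SDL F τ ∧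
    ∀ d : Fin K → Fin N, (A.missing d : ℝ) / SUL = δ ∧ (A.missing d : ℝ) / SDL = δ

/-- `1` if `y = 1`, and `x` otherwise. -/
def sgn (x y : ℚ) : ℚ := if y = 1 then 1 else x

/-- `l = m / gcd (m, L - m)`, used for `m ≤ L`. -/
def ell (L m : ℕ) : ℕ := m / Nat.gcd m (L - m)

/-- `β = (sgn (t/m + 1, m/L) + (L - m)/m) l`. -/
def beta (t L m : ℕ) : ℚ :=
  (sgn ((t : ℚ) / m + 1) ((m : ℚ) / L) + ((L : ℚ) - m) / m) * ell L m

end MIR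

/-! The channel is handled one packet at a time. The `t ≥ L` users storing a packet can create any
vector in `ℂ^L` at the base station, since any `L` columns of the uplink matrix are independent
(`exists_supported_mulVec_eq`). That vector can be chosen so that, forwarded unchanged in the
downlink, it reaches its target and vanishes at up to `L - 1` other users (`exists_zeroForcing`). If
at most `L` served users, the target included, lack each transmitted packet, every served user
receives its own packet with nonzero coefficient plus packets from its cache, and decodes.

What remains is combinatorial: a `DeliveryDesign`. Its balance equation says that `t + L` missing
packets are delivered per transmission, which gives both the delivery time and the sum-DoF
(`achievable`). Replacing each user by `m` identical ones multiplies `t` and `L` by `m` and leaves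
the subpacketization alone (`lift`). Three designs suffice: all `(t + 1)`-subsets of users, for `m =
L` (`ofSubsets`); groups of `m` users helped by `L - m` extra users, for `m < L`
(`nonempty_grouped`); and packets labelled by pointed `(t + L)`-subsets (`nonempty_cyclic`), lifted
by `α` for the second subpacketization and used with a single subset when `t + L = K`. -/

namespace MIR

/-! ### Linear algebra of the channel, and delivery time -/

theorem exists_supported_mulVec_eq {L K : ℕ} (H : Matrix (Fin L) (Fin K) ℂ)
    (hH : ∀ g : Fin L ↪ Fin K, (H.submatrix id g).det ≠ 0) (C : Finset (Fin K))
    (hC : L ≤ C.card) (v : Fin L → ℂ) :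
    ∃ a : Fin K → ℂ, (∀ k, a k ≠ 0 → k ∈ C) ∧ H.mulVec a = v := by
  let g : Fin L ↪ Fin K := (C.orderEmbOfCardLe hC).toEmbedding
  have hg : ∀ i, g i ∈ C := fun i => C.orderEmbOfCardLe_mem hC i
  have hdet : IsUnit (H.submatrix id g).det := isUnit_iff_ne_zero.mpr (hH g)
  let b := (H.submatrix id g)⁻¹.mulVec v
  have hb : (H.submatrix id g).mulVec b = v := by
    simp only [b]
    rw [Matrix.mulVec_mulVec, Matrix.mul_nonsing_inv _ hdet, Matrix.one_mulVec]
  -- The sum is the extension by zero of `b` along the injection `g`.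
  refine ⟨fun k => ∑ i, if g i = k then b i else 0, ?_, ?_⟩
  · intro k hk
    obtain ⟨i, -, hi⟩ := Finset.exists_ne_zero_of_sum_ne_zero hk
    have : g i = k := by
      by_contra h
      simp [h] at hi
    exact this ▸ hg i
  · rw [← hb]
    ext l
    simp only [Matrix.mulVec, dotProduct, Matrix.submatrix_apply, id, Finset.mul_sum]
    rw [Finset.sum_comm]
    refine Finset.sum_congr rfl fun i _ => ?_
    simp

/-- Enlarge `B` to exactly `L` rows; the square submatrix is invertible, and the preimage of the
basis vector belonging to `u` is the beamforming vector. -/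
theorem exists_zeroForcing {L K : ℕ} (hLK : L ≤ K) (G : Matrix (Fin K) (Fin L) ℂ)
    (hG : ∀ g : Fin L ↪ Fin K, (G.submatrix g id).det ≠ 0) (B : Finset (Fin K))
    (hB : B.card ≤ L) {u : Fin K} (hu : u ∈ B) :
    ∃ v : Fin L → ℂ, G.mulVec v u ≠ 0 ∧ ∀ k ∈ B, k ≠ u → G.mulVec v k = 0 := by
  obtain ⟨B', hBB', -, hcard⟩ := Finset.exists_subsuperset_card_eq (Finset.subset_univ B) hB
    (by simpa using hLK)
  let g : Fin L ↪ Fin K := (B'.orderEmbOfFin hcard).toEmbedding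
  have hrange : ∀ k ∈ B', ∃ i, g i = k := fun k hk => by
    have := B'.range_orderEmbOfFin hcard
    have hk' : k ∈ Set.range (B'.orderEmbOfFin hcard) := by rw [this]; exact hk
    exact hk'
  obtain ⟨i₀, hi₀⟩ := hrange u (hBB' hu)
  have hdet : IsUnit (G.submatrix g id).det := isUnit_iff_ne_zero.mpr (hG g)
  let v := (G.submatrix g id)⁻¹.mulVec (Pi.single i₀ 1)
  have hv : (G.submatrix g id).mulVec v = Pi.single i₀ 1 := by
    simp only [v]
    rw [Matrix.mulVec_mulVec, Matrix.mul_nonsing_inv _ hdet, Matrix.one_mulVec]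
  have hv' : ∀ i, G.mulVec v (g i) = (Pi.single i₀ 1 : Fin L → ℂ) i := fun i => by
    rw [← hv]; rfl
  refine ⟨v, ?_, fun k hk hne => ?_⟩
  · rw [← hi₀, hv']; simp
  · obtain ⟨i, rfl⟩ := hrange k (hBB' hk)
    rw [hv', Pi.single_eq_of_ne]
    rintro rfl
    exact hne hi₀

/-- The packet size cancels for `B ≥ 1`, leaving `S / F` times `log P / rate P`, and this last ratio
tends to `1`. -/
theorem hasNDT_div (S F : ℕ) : HasNDT S F ((S : ℝ) / F) := by
  intro rate hrate
  refine ⟨fun P => (S : ℝ) / F * (Real.log P / rate P), Eventually.of_forall fun P => ?_, ?_⟩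
  · refine tendsto_const_nhds.congr' ?_
    filter_upwards [eventually_ge_atTop 1] with B hB
    have hB' : (B : ℝ) ≠ 0 := by positivity
    rw [div_div_eq_mul_div, mul_comm (B : ℝ) (F : ℝ)]
    have : (S : ℝ) * (B / rate P) * Real.log P / (F * B)
        = (S : ℝ) / F * (Real.log P / rate P) * (B / B) := by ring
    rw [this, div_self hB', mul_one]
  · have hlog : ∀ᶠ P in atTop, Real.log P ≠ 0 := by
      filter_upwards [eventually_gt_atTop 1] with P hP using (Real.log_pos hP).ne'
    have h1 : Tendsto (fun P => (rate P - Real.log P) / Real.log P) atTop (𝓝 0) :=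
      hrate.tendsto_div_nhds_zero
    have h2 : Tendsto (fun P => ((rate P - Real.log P) / Real.log P + 1)⁻¹) atTop (𝓝 1) := by
      simpa using (h1.add_const 1).inv₀ (by norm_num)
    have h3 : Tendsto (fun P => Real.log P / rate P) atTop (𝓝 1) := by
      refine h2.congr' ?_
      filter_upwards [hlog] with P hP
      rw [sub_div, div_self hP, sub_add_cancel, inv_div]
    simpa using h3.const_mul ((S : ℝ) / F)

/-! ### Delivery designs and operations on them -/

/-- A combinatorial description of a one-shot delivery to users `U` with transmissions `R`: the
packets are in classes `X` of `β` packets, `stored x` is the set of `t` users storing the packets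
of class `x`, and `serve s u` is the class of the packet that user `u` receives in transmission
`s`, if any. A packet can be nulled at `L - 1` users. -/
structure DeliveryDesign (U X R : Type) [Fintype U] [DecidableEq U] [Fintype X] [DecidableEq X]
    [Fintype R] (t L β : ℕ) where
  stored : X → Finset U
  serve : R → U → Option X
  card_stored : ∀ x, (stored x).card = t
  card_storing : ∀ u,
    (Finset.univ.filter fun x => u ∈ stored x).card * Fintype.card U = t * Fintype.card X
  notMem_stored : ∀ s u x, serve s u = some x → u ∉ stored x
  card_unaware : ∀ s u x, serve s u = some x →
    (Finset.univ.filter fun v => (serve s v).isSome ∧ v ∉ stored x).card ≤ L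
  delivered : ∀ u x, u ∉ stored x → β ≤ (Finset.univ.filter fun s => serve s u = some x).card
  balance : Fintype.card R * (t + L) = Fintype.card X * β * (Fintype.card U - t)

namespace DeliveryDesign

variable {U X R : Type} [Fintype U] [DecidableEq U] [Fintype X] [DecidableEq X] [Fintype R]
  {t L β : ℕ}

/-- Replace every user by `m` users that behave alike. -/
def lift (D : DeliveryDesign U X R t L β) (m : ℕ) :
    DeliveryDesign (U × Fin m) X R (t * m) (L * m) β where
  stored x := D.stored x ×ˢ Finset.univ
  serve s u := D.serve s u.1
  card_stored x := by simp [D.card_stored]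
  card_storing u := by
    have := D.card_storing u.1
    simp only [Finset.mem_product, Finset.mem_univ, and_true, Fintype.card_prod, Fintype.card_fin]
    rw [← mul_assoc, this]; ring
  notMem_stored s u x h := by simpa using D.notMem_stored s u.1 x h
  card_unaware s u x h := by
    have := D.card_unaware s u.1 x h
    have e : (Finset.univ.filter fun v : U × Fin m => (D.serve s v.1).isSome ∧
        v ∉ D.stored x ×ˢ (Finset.univ : Finset (Fin m))) =
        (Finset.univ.filter fun v => (D.serve s v).isSome ∧ v ∉ D.stored x) ×ˢ Finset.univ := by
      ext v; simp
    rw [e, Finset.card_product, Finset.card_univ, Fintype.card_fin]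
    exact Nat.mul_le_mul_right _ this
  delivered u x h := D.delivered u.1 x (by simpa using h)
  balance := by
    have := D.balance
    simp only [Fintype.card_prod, Fintype.card_fin]
    rw [← Nat.sub_mul, ← add_mul, ← mul_assoc, this, mul_assoc]

/-- Name the packets of every class. -/
theorem nonempty_split (D : DeliveryDesign U X R t L β) (hβ : 0 < β) :
    Nonempty (DeliveryDesign U (X × Fin β) R t L 1) := by
  classical
  have : NeZero β := ⟨hβ.ne'⟩
  -- `ρ` tells which of the `β` packets of class `x` user `u` receives in each transmission. At
  -- least `β` transmissions serve `x` to `u`, so all indices can be hit; values at the other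
  -- transmissions are irrelevant.
  have hρ : ∀ u x, ∃ ρ : R → Fin β, u ∉ D.stored x → ∀ i, ∃ s, D.serve s u = some x ∧ ρ s = i := by
    intro u x
    by_cases hu : u ∈ D.stored x
    · exact ⟨fun _ => 0, fun h => absurd hu h⟩
    · have hcard := D.delivered u x hu
      let g : Fin β ↪ R := ⟨fun i => ((Finset.univ.filter fun s => D.serve s u = some x).equivFin.symm
        (Fin.castLE hcard i)).1, fun i j hij => by simpa [Subtype.ext_iff] using Subtype.ext hij⟩
      have hg : ∀ i, D.serve (g i) u = some x := fun i => by
        have := ((Finset.univ.filter fun s => D.serve s u = some x).equivFin.symm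
          (Fin.castLE hcard i)).2
        exact (Finset.mem_filter.mp this).2
      exact ⟨Function.invFun g, fun _ i => ⟨g i, hg i, Function.leftInverse_invFun g.injective i⟩⟩
  choose ρ hρ using hρ
  refine ⟨{
    stored := fun x => D.stored x.1
    serve := fun s u => (D.serve s u).map fun x => (x, ρ u x s)
    card_stored := fun x => D.card_stored x.1
    card_storing := fun u => ?_
    notMem_stored := fun s u x h => ?_
    card_unaware := fun s u x h => ?_
    delivered := fun u x h => ?_
    balance := ?_ }⟩
  · have e : (Finset.univ.filter fun x : X × Fin β => u ∈ D.stored x.1) =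
        (Finset.univ.filter fun x => u ∈ D.stored x) ×ˢ Finset.univ := by
      ext v; simp
    rw [e, Finset.card_product, Finset.card_univ, Fintype.card_prod, Fintype.card_fin,
      mul_right_comm, D.card_storing, mul_assoc]
  · obtain ⟨y, hy, rfl⟩ := Option.map_eq_some_iff.mp h
    exact D.notMem_stored s u y hy
  · obtain ⟨y, hy, rfl⟩ := Option.map_eq_some_iff.mp h
    simpa using D.card_unaware s u y hy
  · obtain ⟨s, hs, hs'⟩ := hρ u x.1 h x.2
    refine Finset.card_pos.mpr ⟨s, ?_⟩
    simp [hs, hs']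
  · rw [Fintype.card_prod, Fintype.card_fin, mul_one, D.balance]

/-- Relabel users, packet classes and transmissions. -/
def reindex {U' X' R' : Type} [Fintype U'] [DecidableEq U'] [Fintype X'] [DecidableEq X']
    [Fintype R'] (D : DeliveryDesign U X R t L β) (eU : U ≃ U') (eX : X ≃ X') (eR : R ≃ R') :
    DeliveryDesign U' X' R' t L β where
  stored x := (D.stored (eX.symm x)).map eU.toEmbedding
  serve s u := (D.serve (eR.symm s) (eU.symm u)).map eX
  card_stored x := by simp [D.card_stored]
  card_storing u := by
    rw [← Fintype.card_congr eU, ← Fintype.card_congr eX, ← D.card_storing (eU.symm u)]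
    congr 1
    refine Finset.card_equiv eX.symm fun x => ?_
    simp [Finset.mem_map_equiv]
  notMem_stored s u x h := by
    obtain ⟨y, hy, rfl⟩ := Option.map_eq_some_iff.mp h
    simpa [Finset.mem_map_equiv] using D.notMem_stored _ _ y hy
  card_unaware s u x h := by
    obtain ⟨y, hy, rfl⟩ := Option.map_eq_some_iff.mp h
    refine le_trans (le_of_eq ?_) (D.card_unaware _ _ y hy)
    refine Finset.card_equiv eU.symm fun x => ?_
    simp [Finset.mem_map_equiv]
  delivered u x h := by
    refine (D.delivered (eU.symm u) (eX.symm x) (by simpa [Finset.mem_map_equiv] using h)).trans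
      (le_of_eq ?_)
    refine Finset.card_equiv eR fun s => ?_
    simp only [Finset.mem_filter, Finset.mem_univ, true_and, Equiv.symm_apply_apply,
      Option.map_eq_some_iff]
    constructor
    · intro hs
      exact ⟨_, hs, by simp⟩
    · rintro ⟨y, hy, rfl⟩
      simpa using hy
  balance := by
    rw [← Fintype.card_congr eU, ← Fintype.card_congr eX, ← Fintype.card_congr eR, D.balance]

/-! ### From designs to coded caching schemes -/

/-- For every channel state in general position, users storing a packet can send it so that the
base station, forwarding what it receives, delivers it to `u` and nulls it wherever it disturbs. -/
theorem exists_signal {K F S : ℕ} (D : DeliveryDesign (Fin K) (Fin F) (Fin S) t L β)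
    (hLK : L ≤ K) (hLt : L ≤ t) {c : Channel L K S S} (hc : c.GeneralPosition)
    {s : Fin S} {u : Fin K} {x : Fin F} (h : D.serve s u = some x) :
    ∃ a : Fin K → ℂ, (∀ k, a k ≠ 0 → k ∈ D.stored x) ∧
      (c.down s).mulVec ((c.up s).mulVec a) u ≠ 0 ∧
      ∀ k, (D.serve s k).isSome → k ∉ D.stored x → k ≠ u →
        (c.down s).mulVec ((c.up s).mulVec a) k = 0 := by
  obtain ⟨v, hvu, hv⟩ := exists_zeroForcing hLK (c.down s) (hc.2 s) _ (D.card_unaware s u x h)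
    (u := u) (by simp [h, D.notMem_stored s u x h])
  obtain ⟨a, ha, rfl⟩ := exists_supported_mulVec_eq (c.up s) (hc.1 s) (D.stored x)
    (by rw [D.card_stored]; exact hLt) v
  exact ⟨a, ha, hvu, fun k h1 h2 h3 => hv k (by simp [h1, h2]) h3⟩

open Classical in
/-- The scheme of a delivery design: the signal for a served user is sent with coefficients `a`
and the base station forwards the received signals. -/
noncomputable def scheme {K F S : ℕ} (N : ℕ) (D : DeliveryDesign (Fin K) (Fin F) (Fin S) t L β)
    (a : Channel L K S S → Fin S → Fin K → Fin K → ℂ) : SchemeData L K N F S S where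
  cache k := Finset.univ.filter fun p => k ∈ D.stored p.2
  V d c s k p := ∑ u, if (D.serve s u).map (fun x => (d u, x)) = some p then a c s u k else 0
  U _ _ s' l q := if q = (s', l) then 1 else 0

variable {K F S N : ℕ} (D : DeliveryDesign (Fin K) (Fin F) (Fin S) t L β)
  (a : Channel L K S S → Fin S → Fin K → Fin K → ℂ)

theorem scheme_userSignal (d : Fin K → Fin N) (c : Channel L K S S) {b : ℕ} (W : Library N F b)
    (s : Fin S) (k : Fin K) :
    (D.scheme N a).userSignal d c W s k =
      ∑ u, a c s u k • (D.serve s u).elim 0 (fun x => W (d u) x) := by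
  simp only [SchemeData.userSignal, scheme, Finset.sum_smul]
  rw [Finset.sum_comm]
  refine Finset.sum_congr rfl fun u _ => ?_
  cases h : D.serve s u with
  | none => simp
  | some x =>
    rw [Finset.sum_eq_single (d u, x)]
    · simp
    · intro p _ hp
      simp [hp.symm]
    · simp

theorem scheme_userReceived (d : Fin K → Fin N) (c : Channel L K S S) {b : ℕ} (W : Library N F b)
    (k : Fin K) (s : Fin S) :
    (D.scheme N a).userReceived d c W k s =
      ∑ u, (c.down s).mulVec ((c.up s).mulVec (a c s u)) k •
        (D.serve s u).elim 0 (fun x => W (d u) x) := by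
  have h1 : ∀ l, (D.scheme N a).baseSignal d c W s l =
      ∑ u, (c.up s).mulVec (a c s u) l • (D.serve s u).elim 0 (fun x => W (d u) x) := by
    intro l
    have : (D.scheme N a).baseSignal d c W s l = (D.scheme N a).baseReceived d c W s l := by
      simp [SchemeData.baseSignal, scheme]
    rw [this, SchemeData.baseReceived]
    simp only [scheme_userSignal, Finset.smul_sum, Matrix.mulVec, dotProduct, Finset.sum_smul,
      smul_smul]
    rw [Finset.sum_comm]
  rw [SchemeData.userReceived]
  simp only [h1, Finset.smul_sum, smul_smul]
  rw [Finset.sum_comm]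
  refine Finset.sum_congr rfl fun u _ => ?_
  rw [← Finset.sum_smul]
  rfl

theorem achievable_fin {K F S N : ℕ} {M : ℝ} (D : DeliveryDesign (Fin K) (Fin F) (Fin S) t L 1)
    (hN : 0 < N) (hF : 0 < F) (hL : 0 < L) (hM : (t : ℝ) = K * M / N) (htL : t + L ≤ K)
    (hLt : L ≤ t) :
    Achievable L K N F M (K * (1 - M / N) / (t + L)) (t + L) := by
  classical
  have hN' : (N : ℝ) ≠ 0 := by positivity
  have hK' : (0 : ℝ) < K := by exact_mod_cast (by omega : 0 < K)
  have hKM : (K : ℝ) * M = t * N := by rw [hM]; field_simp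
  have hbal : S * (t + L) = F * (K - t) := by simpa using D.balance
  have hbalR : (S : ℝ) * (t + L) = F * (K - t) := by
    rw [← Nat.cast_sub (by omega : t ≤ K)]; exact_mod_cast hbal
  -- Since `L > 0` gives `t < K`, balance rules out `S = 0`.
  have hS : 0 < S := by
    rcases Nat.eq_zero_or_pos S with rfl | h
    · rw [zero_mul] at hbal
      have := Nat.mul_pos hF (by omega : 0 < K - t)
      omega
    · exact h
  have hFR : (F : ℝ) ≠ 0 := by positivity
  have hSR : (S : ℝ) ≠ 0 := by positivity
  have htLR : (t : ℝ) + L ≠ 0 := by positivity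
  have hτ : (K : ℝ) * (1 - M / N) / (t + L) = (S : ℝ) / F := by
    rw [div_eq_div_iff htLR hFR, hbalR]
    have : (K : ℝ) * (1 - M / N) = K - t := by rw [hM]; ring
    rw [this]; ring
  have hc : ∀ k : Fin K, (Finset.univ.filter fun x => k ∈ D.stored x).card * K = t * F :=
    fun k => by simpa using D.card_storing k
  have hmem : ∀ (a) (k : Fin K) (p : Fin N × Fin F),
      p ∈ (D.scheme N a).cache k ↔ k ∈ D.stored p.2 := by
    intro a k p
    simp [scheme]
  -- The support condition is required for every channel state, so outside general position the
  -- coefficients are set to zero.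
  have hex : ∀ (c : Channel L K S S) (s : Fin S) (u : Fin K), ∃ a : Fin K → ℂ,
      ∀ x, D.serve s u = some x → (∀ k, a k ≠ 0 → k ∈ D.stored x) ∧ (c.GeneralPosition →
        (c.down s).mulVec ((c.up s).mulVec a) u ≠ 0 ∧
        ∀ k, (D.serve s k).isSome → k ∉ D.stored x → k ≠ u →
          (c.down s).mulVec ((c.up s).mulVec a) k = 0) := by
    intro c s u
    by_cases hgp : c.GeneralPosition
    · cases h : D.serve s u with
      | none => exact ⟨0, fun x hx => by simp at hx⟩
      | some x =>
        obtain ⟨a, h1, h2⟩ := D.exists_signal (by omega) hLt hgp h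
        refine ⟨a, fun y hy => ?_⟩
        obtain rfl : x = y := by simpa using hy
        exact ⟨h1, fun _ => h2⟩
    · exact ⟨0, fun x _ => ⟨fun k hk => absurd rfl hk, fun h => absurd h hgp⟩⟩
  choose a ha using hex
  have hmissing : ∀ d : Fin K → Fin N, ((D.scheme N a).missing d : ℝ) / S = t + L := by
    intro d
    rw [div_eq_iff hSR, mul_comm, hbalR]
    have hk : ∀ k : Fin K, ((Finset.univ.filter fun f : Fin F =>
        (d k, f) ∉ (D.scheme N a).cache k).card : ℝ) = F * (K - t) / K := by
      intro k
      simp only [hmem]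
      have h1 := Finset.card_filter_add_card_filter_not (s := (Finset.univ : Finset (Fin F)))
        (fun x => k ∈ D.stored x)
      rw [Finset.card_univ, Fintype.card_fin] at h1
      have h1' : ((Finset.univ.filter fun x => k ∈ D.stored x).card : ℝ) +
          (Finset.univ.filter fun x => k ∉ D.stored x).card = F := by exact_mod_cast h1
      have h2 : ((Finset.univ.filter fun x => k ∈ D.stored x).card : ℝ) * K = t * F := by
        exact_mod_cast hc k
      rw [eq_div_iff hK'.ne']
      linear_combination (K : ℝ) * h1' - h2
    rw [SchemeData.missing, Nat.cast_sum, Finset.sum_congr rfl fun k _ => hk k, Finset.sum_const,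
      Finset.card_univ, Fintype.card_fin, nsmul_eq_mul]
    field_simp
  refine ⟨S, S, D.scheme N a, ⟨fun k => ?_, fun d c s k p h => ?_, fun d c hgp b k => ?_⟩,
    hτ ▸ hasNDT_div S F, hτ ▸ hasNDT_div S F, fun d => ⟨hmissing d, hmissing d⟩⟩
  · have e : (D.scheme N a).cache k =
        (Finset.univ : Finset (Fin N)) ×ˢ (Finset.univ.filter fun x => k ∈ D.stored x) := by
      ext p; simp [hmem]
    have h2 : ((Finset.univ.filter fun x => k ∈ D.stored x).card : ℝ) * K = t * F := by
      exact_mod_cast hc k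
    rw [e, Finset.card_product, Finset.card_univ, Fintype.card_fin, Nat.cast_mul]
    refine le_of_eq (mul_right_cancel₀ hK'.ne' ?_)
    linear_combination (N : ℝ) * h2 - (F : ℝ) * hKM
  · simp only [scheme] at h
    obtain ⟨u, -, hu⟩ := Finset.exists_ne_zero_of_sum_ne_zero h
    rw [ne_eq, ite_eq_right_iff, Classical.not_imp] at hu
    obtain ⟨x, hx, rfl⟩ := Option.map_eq_some_iff.mp hu.1
    exact ⟨(hmem _ _ _).mpr ((ha c s u x hx).1 k hu.2), u, rfl⟩
  -- No decoder is written down: it suffices that what user `k` sees determines its file, and a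
  -- function extending this dependence then decodes.
  · have key : ∀ W W' : Library N F b, (D.scheme N a).cached W k = (D.scheme N a).cached W' k →
        (D.scheme N a).userReceived d c W k = (D.scheme N a).userReceived d c W' k →
        W (d k) = W' (d k) := by
      intro W W' hcache hrec
      have hcache' : ∀ n f, k ∈ D.stored f → W n f = W' n f := fun n f hf =>
        congrFun hcache ⟨(n, f), (hmem _ _ _).mpr hf⟩
      ext1 f
      by_cases hf : k ∈ D.stored f
      · exact hcache' _ _ hf
      obtain ⟨s, hs⟩ := Finset.card_pos.mp (D.delivered k f hf)
      replace hs : D.serve s k = some f := (Finset.mem_filter.mp hs).2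
      have hr := congrFun hrec s
      rw [scheme_userReceived, scheme_userReceived,
        ← Finset.add_sum_erase _ _ (Finset.mem_univ k),
        ← Finset.add_sum_erase _ _ (Finset.mem_univ k)] at hr
      -- An interfering packet is either cached by `k`, hence equal in both libraries, or nulled at
      -- `k`.
      have hrest : ∀ u ∈ Finset.univ.erase k,
          (c.down s).mulVec ((c.up s).mulVec (a c s u)) k •
            (D.serve s u).elim 0 (fun x => W (d u) x) =
          (c.down s).mulVec ((c.up s).mulVec (a c s u)) k •
            (D.serve s u).elim 0 (fun x => W' (d u) x) := by
        intro u hu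
        cases hx : D.serve s u with
        | none => rfl
        | some x =>
          by_cases hkx : k ∈ D.stored x
          · simp [hcache' _ _ hkx]
          · rw [((ha c s u x hx).2 hgp).2 k (by simp [hs]) hkx (Finset.ne_of_mem_erase hu).symm,
              zero_smul, zero_smul]
      rw [Finset.sum_congr rfl hrest, add_left_inj, hs] at hr
      exact smul_right_injective _ ((ha c s k f hs).2 hgp).1 hr
    have hfac : Function.FactorsThrough (fun W : Library N F b => W (d k))
        (fun W => ((D.scheme N a).cached W k, (D.scheme N a).userReceived d c W k)) :=
      fun W W' h => key W W' (congrArg Prod.fst h) (congrArg Prod.snd h)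
    exact ⟨fun z y => Function.extend _ (fun W : Library N F b => W (d k))
      (fun _ => 0) (z, y),
      fun W => hfac.extend_apply _ W⟩

theorem achievable {K N : ℕ} {M : ℝ} (D : DeliveryDesign U X R t L β) (hU : Fintype.card U = K)
    (hβ : 0 < β) (hX : 0 < Fintype.card X)
    (hN : 0 < N) (hL : 0 < L) (hM : (t : ℝ) = K * M / N) (htL : t + L ≤ K) (hLt : L ≤ t) :
    Achievable L K N (Fintype.card X * β) M (K * (1 - M / N) / (t + L)) (t + L) := by
  obtain ⟨D'⟩ := D.nonempty_split hβ
  have hF : Fintype.card (X × Fin β) = Fintype.card X * β := by simp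
  exact (D'.reindex (Fintype.equivFinOfCardEq hU) (Fintype.equivFinOfCardEq hF)
    (Fintype.equivFin R)).achievable_fin hN (Nat.mul_pos hX hβ) hL hM htL hLt

end DeliveryDesign

/-! ### Counting subsets, and cyclic orders -/

/-- Transpositions show that all points lie in equally many `r`-subsets; double counting incidences
gives the common value. -/
theorem card_subsets_containing {U : Type} [Fintype U] [DecidableEq U] (r : ℕ) (u : U) :
    (Finset.univ.filter fun T : {T : Finset U // T.card = r} => u ∈ T.1).card * Fintype.card U =
      r * Fintype.card {T : Finset U // T.card = r} := by
  have hunif : ∀ v, (Finset.univ.filter fun T : {T : Finset U // T.card = r} => v ∈ T.1).card =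
      (Finset.univ.filter fun T : {T : Finset U // T.card = r} => u ∈ T.1).card := by
    intro v
    have hle : ∀ v w : U, (Finset.univ.filter fun T : {T : Finset U // T.card = r} =>
        v ∈ T.1).card ≤
        (Finset.univ.filter fun T : {T : Finset U // T.card = r} => w ∈ T.1).card := by
      intro v w
      refine Finset.card_le_card_of_injOn
        (fun T => ⟨T.1.map (Equiv.swap v w).toEmbedding, by simp [T.2]⟩) ?_ ?_
      · intro T hT
        simpa [Finset.mem_map_equiv] using hT
      · intro T _ T' _ h
        simpa [Subtype.ext_iff] using h
    exact le_antisymm (hle v u) (hle u v)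
  have h1 : ∑ v : U, (Finset.univ.filter fun T : {T : Finset U // T.card = r} => v ∈ T.1).card =
      ∑ _T : {T : Finset U // T.card = r}, r := by
    simp only [Finset.card_filter]
    rw [Finset.sum_comm]
    refine Finset.sum_congr rfl fun T _ => ?_
    simp [T.2]
  rw [Finset.sum_congr rfl fun v _ => hunif v] at h1
  simp only [Finset.sum_const, Finset.card_univ, smul_eq_mul] at h1
  rw [mul_comm, h1, mul_comm]

/-- Provides a cyclic order on `S`. Off `S`, `pos` has the junk value `0`, hence the membership
hypothesis in the last clause. -/
theorem exists_cyclic_labelling {G : Type} [DecidableEq G] (S : Finset G) {n : ℕ}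
    [NeZero n] (hS : S.card = n) : ∃ (pos : G → ZMod n) (inv : ZMod n → G),
      (∀ z, inv z ∈ S) ∧ (∀ z, pos (inv z) = z) ∧ ∀ g ∈ S, inv (pos g) = g := by
  have e : S ≃ ZMod n := Fintype.equivOfCardEq (by simp [hS, ZMod.card])
  refine ⟨fun g => if h : g ∈ S then e ⟨g, h⟩ else 0, fun z => (e.symm z).1,
    fun z => (e.symm z).2, fun z => by simp, fun g hg => by simp [hg]⟩

theorem card_insert_erase {G : Type} [DecidableEq G] {T : Finset G} {r : ℕ} (hT : T.card = r)
    {g h : G} (hg : g ∉ T) (hh : h ∈ T) : (insert g (T.erase h)).card = r := by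
  rw [Finset.card_insert_of_notMem (fun h' => hg (Finset.mem_of_mem_erase h')),
    Finset.card_erase_add_one hh, hT]

theorem insert_erase_insert_erase {G : Type} [DecidableEq G] {T : Finset G} {g h : G}
    (hg : g ∈ T) (hh : h ∉ T) : insert g ((insert h (T.erase g)).erase h) = T := by
  rw [Finset.erase_insert (fun h' => hh (Finset.mem_of_mem_erase h')), Finset.insert_erase hg]

theorem natCast_ne_zero_of_pos_of_lt {n k : ℕ} (h0 : 0 < k) (h : k < n) : (k : ZMod n) ≠ 0 := by
  rw [Ne, ZMod.natCast_eq_zero_iff]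
  exact Nat.not_dvd_of_pos_of_lt h0 h

theorem natCast_inj_of_lt {n j k : ℕ} (hj : j < n) (hk : k < n) (h : (j : ZMod n) = k) :
    j = k := by
  rw [ZMod.natCast_eq_natCast_iff'] at h
  rwa [Nat.mod_eq_of_lt hj, Nat.mod_eq_of_lt hk] at h

theorem card_subset_notMem (G : Type) [Fintype G] [DecidableEq G] (r : ℕ) :
    Fintype.card {p : {T : Finset G // T.card = r} × G // p.2 ∉ p.1.1} =
      Fintype.card {T : Finset G // T.card = r} * (Fintype.card G - r) := by
  rw [Fintype.card_subtype, Finset.card_filter, Fintype.sum_prod_type]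
  have : ∀ T : {T : Finset G // T.card = r},
      (∑ g : G, if g ∉ T.1 then 1 else 0) = Fintype.card G - r := by
    intro T
    have hT : (Finset.univ.filter fun g => g ∉ T.1) = T.1ᶜ := by
      ext g; simp
    rw [← Finset.card_filter, hT, Finset.card_compl, T.2]
  simp only [this]
  simp

/-! ### The subset design and the cyclic design -/

namespace DeliveryDesign

/-- Every set of `t + 1` users exchanges the packets that each of them misses and the others
store. -/
def ofSubsets (G : Type) [Fintype G] [DecidableEq G] (t : ℕ) :
    DeliveryDesign G {T : Finset G // T.card = t} {V : Finset G // V.card = t + 1} t 1 1 where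
  stored T := T.1
  serve V u := if h : u ∈ V.1 then some ⟨V.1.erase u, by rw [Finset.card_erase_of_mem h, V.2]; rfl⟩
    else none
  card_stored T := T.2
  card_storing u := card_subsets_containing t u
  notMem_stored V u T h := by
    split_ifs at h with hu
    obtain rfl := Option.some_injective _ h
    simp
  card_unaware V u T h := by
    split_ifs at h with hu
    obtain rfl := Option.some_injective _ h
    -- Every member of `V` other than `u` stores the packet.
    refine (Finset.card_le_card (t := {u}) fun v hv => ?_).trans (by simp)
    by_cases hv' : v ∈ V.1 <;> simp_all
  delivered u T h := by
    refine Finset.card_pos.mpr ⟨⟨insert u T.1, by rw [Finset.card_insert_of_notMem h, T.2]⟩, ?_⟩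
    simp [Finset.erase_insert h]
  balance := by
    rw [Fintype.card_finset_len, Fintype.card_finset_len, mul_one, Nat.choose_succ_right_eq]

/-- Packets are labelled by a set of `t + L` users and an element of it, and are stored by the `t`
users following it in a cyclic order of the set. -/
theorem nonempty_cyclic (U : Type) [Fintype U] [DecidableEq U] {t L : ℕ} [NeZero (t + L)]
    (hL : 0 < L) (htL : t + L ≤ Fintype.card U) :
    Nonempty (DeliveryDesign U ({Q : Finset U // Q.card = t + L} × ZMod (t + L))
      (({Q : Finset U // Q.card = t + L} × Fin L) ⊕
        {p : {Q : Finset U // Q.card = t + L} × U // p.2 ∉ p.1.1}) t L 1) := by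
  choose pos inv hinv hpos hinvpos using
    fun Q : {Q : Finset U // Q.card = t + L} => exists_cyclic_labelling Q.1 Q.2
  let stored : {Q : Finset U // Q.card = t + L} × ZMod (t + L) → Finset U := fun x =>
    Finset.univ.image fun i : Fin t => inv x.1 (x.2 + ((i + 1 : ℕ) : ZMod (t + L)))
  have hmem : ∀ x u, u ∈ stored x ↔
      u ∈ x.1.1 ∧ ∃ i < t, pos x.1 u = x.2 + ((i + 1 : ℕ) : ZMod (t + L)) := by
    intro x u
    simp only [stored, Finset.mem_image, Finset.mem_univ, true_and]
    constructor
    · rintro ⟨i, rfl⟩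
      exact ⟨hinv _ _, i, i.2, hpos _ _⟩
    · rintro ⟨hu, i, hi, h⟩
      exact ⟨⟨i, hi⟩, by rw [← h, hinvpos _ _ hu]⟩
  have hcard : ∀ x, (stored x).card = t := by
    intro x
    simp only [stored]
    rw [Finset.card_image_of_injective, Finset.card_univ, Fintype.card_fin]
    intro i j hij
    have h := add_left_cancel ((hpos _ _).symm.trans ((congrArg (pos x.1) hij).trans (hpos _ _)))
    have := natCast_inj_of_lt (by omega) (by omega) h
    exact Fin.ext (by omega)
  have hunaware : ∀ (Q : Finset U) x, Q.card = t + L → stored x ⊆ Q →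
      (Finset.univ.filter fun v => v ∈ Q ∧ v ∉ stored x).card ≤ L := by
    intro Q x hQ hx
    have e : (Finset.univ.filter fun v => v ∈ Q ∧ v ∉ stored x) = Q \ stored x := by
      ext v; simp
    rw [e, Finset.card_sdiff_of_subset hx, hQ, hcard]
    omega
  refine ⟨{
    stored := stored
    -- Transmissions `(Q, i)` with `i < L` serve the members of `Q` with packets labelled by `Q`.
    -- Transmissions `(Q, j)` with `j ∉ Q` serve each `u ∈ Q` with the packet labelled by `Q` with
    -- `u` replaced by `j`, pointed at `j`; its storing users follow `j`, so they all lie in `Q`.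
    serve := Sum.elim
      (fun s u => if u ∈ s.1.1 then some (s.1, pos s.1 u + ((s.2 : ℕ) : ZMod (t + L))) else none)
      (fun s u => if h : u ∈ s.1.1.1 then
        some (⟨insert s.1.2 (s.1.1.1.erase u), card_insert_erase s.1.1.2 s.2 h⟩,
          pos ⟨insert s.1.2 (s.1.1.1.erase u), card_insert_erase s.1.1.2 s.2 h⟩ s.1.2) else none)
    card_stored := hcard
    card_storing := fun u => ?_
    notMem_stored := ?_
    card_unaware := ?_
    delivered := fun u x h => ?_
    balance := ?_ }⟩
  -- For each `Q` containing `u`, the packets stored by `u` are pointed at the `t` positions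
  -- preceding that of `u`.
  · have e : (Finset.univ.filter fun x => u ∈ stored x) =
        ((Finset.univ.filter fun Q : {Q : Finset U // Q.card = t + L} => u ∈ Q.1) ×ˢ
          (Finset.univ : Finset (Fin t))).image
          fun y => (y.1, pos y.1 u - ((y.2 + 1 : ℕ) : ZMod (t + L))) := by
      ext ⟨Q, z⟩
      simp only [Finset.mem_filter, Finset.mem_univ, true_and, hmem, Finset.mem_image,
        Finset.mem_product, and_true, Prod.exists, Prod.mk.injEq]
      constructor
      · rintro ⟨hu, i, hi, h⟩
        exact ⟨Q, ⟨i, hi⟩, hu, rfl, by rw [h, add_sub_cancel_right]⟩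
      · rintro ⟨Q', i, hu, rfl, rfl⟩
        exact ⟨hu, i, i.2, by rw [sub_add_cancel]⟩
    rw [e, Finset.card_image_of_injective, Finset.card_product, Finset.card_univ, Fintype.card_fin,
      Fintype.card_prod, ZMod.card, mul_right_comm, card_subsets_containing]
    · ring
    · rintro ⟨Q, i⟩ ⟨Q', j⟩ h
      simp only [Prod.mk.injEq] at h
      obtain ⟨rfl, h⟩ := h
      have := natCast_inj_of_lt (by omega) (by omega) (sub_right_injective h)
      exact Prod.ext rfl (Fin.ext (by simpa using this))
  · rintro (⟨Q, i⟩ | ⟨⟨Q, j⟩, hj⟩) u x h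
    · simp only [Sum.elim_inl] at h
      split_ifs at h with hu
      obtain rfl := Option.some_injective _ h
      rw [hmem]
      rintro ⟨-, i', hi', h'⟩
      simp only [add_assoc, left_eq_add, ← Nat.cast_add] at h'
      exact natCast_ne_zero_of_pos_of_lt (by omega) (by omega) h'
    · simp only [Sum.elim_inr] at h
      split_ifs at h with hu
      obtain rfl := Option.some_injective _ h
      rw [hmem]
      rintro ⟨h', -⟩
      simp only [Finset.mem_insert, Finset.mem_erase, ne_eq, not_true_eq_false, false_and,
        or_false] at h'
      exact hj (h' ▸ hu)
  · rintro (⟨Q, i⟩ | ⟨⟨Q, j⟩, hj⟩) u x h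
    · simp only [Sum.elim_inl] at h ⊢
      split_ifs at h with hu
      have hx := (Option.some_injective _ h).symm
      refine (Finset.card_le_card fun v hv => ?_).trans (hunaware Q.1 x Q.2 fun v hv => ?_)
      · by_cases hv' : v ∈ Q.1 <;> simp_all
      · rw [hx] at hv
        exact ((hmem _ _).mp hv).1
    · simp only [Sum.elim_inr] at h ⊢
      split_ifs at h with hu
      have hx := (Option.some_injective _ h).symm
      refine (Finset.card_le_card fun v hv => ?_).trans (hunaware Q.1 x Q.2 fun v hv => ?_)
      · by_cases hv' : v ∈ Q.1 <;> simp_all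
      · rw [hx] at hv
        obtain ⟨h1, i, hi, h2⟩ := (hmem _ _).mp hv
        rcases Finset.mem_insert.mp h1 with rfl | h1
        · rw [left_eq_add] at h2
          exact absurd h2 (natCast_ne_zero_of_pos_of_lt (by omega) (by omega))
        · exact Finset.mem_of_mem_erase h1
  · refine Finset.card_pos.mpr ?_
    obtain ⟨Q, z⟩ := x
    rw [hmem] at h
    by_cases hu : u ∈ Q.1
    · have hw : (((z - pos Q u).val : ℕ) : ZMod (t + L)) = z - pos Q u := ZMod.natCast_zmod_val _
      have hlt := ZMod.val_lt (z - pos Q u)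
      -- A user at distance `w ≥ L` before the point `z` comes `t + L - w ≤ t` steps after it
      -- cyclically, and would store the packet.
      have hwL : (z - pos Q u).val < L := by
        by_contra hge
        refine h ⟨hu, t + L - 1 - (z - pos Q u).val, by omega, ?_⟩
        have h1 : t + L - 1 - (z - pos Q u).val + 1 + (z - pos Q u).val = t + L := by omega
        have h2 := congrArg (Nat.cast : ℕ → ZMod (t + L)) h1
        rw [ZMod.natCast_self, Nat.cast_add, hw] at h2
        linear_combination -h2
      refine ⟨Sum.inl (Q, ⟨_, hwL⟩), ?_⟩
      simp only [Finset.mem_filter, Finset.mem_univ, true_and, Sum.elim_inl, hu, if_true, hw]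
      simp
    · have hz := hinv Q z
      -- A user outside `Q` takes the place of the distinguished element; exchanging them back
      -- recovers `Q`.
      refine ⟨Sum.inr ⟨(⟨insert u (Q.1.erase (inv Q z)), card_insert_erase Q.2 hu hz⟩, inv Q z),
        ?_⟩, ?_⟩
      · simp only [Finset.mem_insert, Finset.mem_erase, ne_eq, not_true_eq_false, false_and,
          or_false]
        rintro h'
        exact hu (h' ▸ hz)
      · refine Finset.mem_filter.mpr ⟨Finset.mem_univ _, ?_⟩
        have key : ∀ Q', Q' = Q → some (Q', pos Q' (inv Q z)) = some (Q, z) := by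
          rintro _ rfl
          rw [hpos]
        rw [Sum.elim_inr, dif_pos (Finset.mem_insert_self _ _)]
        exact key _ (Subtype.ext (insert_erase_insert_erase hz hu))
  · rw [Fintype.card_sum, card_subset_notMem, Fintype.card_prod, Fintype.card_prod, Fintype.card_fin,
      ZMod.card, ← mul_add, mul_one, mul_right_comm]
    congr 2
    omega

end DeliveryDesign

/-! ### The grouped design -/

/-- Slots with numbers `q * m + i` are cut into rounds of length `e`. Two distinct ones in the same
round are at least `m` apart, so their offsets differ after division by `m`. This separates the
extra deliveries to one user below. -/
theorem eq_of_div_eq_of_mod_div_eq {m e i q q' : ℕ} (h : (q * m + i) / e = (q' * m + i) / e)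
    (h' : (q * m + i) % e / m = (q' * m + i) % e / m) (hm : 0 < m) : q = q' := by
  have key : ∀ a b : ℕ, (a * m + i) / e = (b * m + i) / e →
      (a * m + i) % e / m = (b * m + i) % e / m → a ≤ b := by
    intro a b h h'
    by_contra hab
    have h1 := Nat.div_add_mod (a * m + i) e
    have h2 := Nat.div_add_mod (b * m + i) e
    rw [h] at h1
    have h3 : (b + 1) * m ≤ a * m := Nat.mul_le_mul_right m (by omega)
    rw [add_mul, one_mul] at h3
    have h4 : (b * m + i) % e + m ≤ (a * m + i) % e := by omega
    have h5 := Nat.div_le_div_right (c := m) h4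
    rw [Nat.add_div_right _ hm] at h5
    omega
  exact le_antisymm (key _ _ h h') (key _ _ h.symm h'.symm)

namespace DeliveryDesign

/-- Users form groups `G` of `m`. In the transmissions labelled by a set `T` of `t` groups and a
group `g` outside `T`, the groups in `T` and `g` exchange packets, and `e` more users outside
these groups, chosen cyclically, receive packets stored by `T`. -/
theorem nonempty_grouped (G : Type) [Fintype G] [DecidableEq G] {t m e l q : ℕ} (hm : 0 < m)
    (htG : t < Fintype.card G) (hq : q * m = l * e) (he : m + e ≤ (Fintype.card G - t) * m) :
    Nonempty (DeliveryDesign (G × Fin m) {T : Finset G // T.card = t}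
      ({p : {T : Finset G // T.card = t} × G // p.2 ∉ p.1.1} × Fin l) (t * m) (m + e)
      (l * (t + 1) + q)) := by
  classical
  obtain ⟨n, hn⟩ : ∃ n, n = Fintype.card G - t := ⟨_, rfl⟩
  have : NeZero n := ⟨by omega⟩
  have hcompl : ∀ T : {T : Finset G // T.card = t}, T.1ᶜ.card = n := fun T => by
    rw [Finset.card_compl, T.2, hn]
  choose pos inv hinv hpos hinvpos using
    fun T : {T : Finset G // T.card = t} => exists_cyclic_labelling T.1ᶜ (hcompl T)
  -- The `e` extra users fit into the `n - 1` groups outside `T` and `g`, so a shift by `j / m + 1`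
  -- never returns to `g`.
  have hshift : ∀ j, j < e → j / m + 1 < n := by
    intro j hj
    have : j < (n - 1) * m := by
      rw [← hn] at he
      have : (n - 1) * m + m = n * m := by
        rw [← Nat.succ_mul]; congr 1; have := NeZero.ne n; omega
      omega
    have := (Nat.div_lt_iff_lt_mul hm).mpr this
    omega
  -- For fixed `T` and `g`, the `l` rounds have `l * e = q * m` extra slots in all, numbered `a * e
  -- + j`. The number mod `m` selects the member of a group, so each member index occurs `q` times;
  -- `j / m + 1` is the cyclic distance of the group from `g`.
  let extra : {p : {T : Finset G // T.card = t} × G // p.2 ∉ p.1.1} × Fin l → Fin e → G × Fin m :=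
    fun s j => (inv s.1.1.1 (pos s.1.1.1 s.1.1.2 + ((j / m + 1 : ℕ) : ZMod n)),
      ⟨(s.2 * e + j) % m, Nat.mod_lt _ hm⟩)
  -- In both kinds of delivery, the served users lacking the packet lie in one group or among the
  -- extra users.
  have hunaware : ∀ (A : Finset (G × Fin m)) (h : G) s,
      (∀ v ∈ A, v.1 = h ∨ ∃ j, extra s j = v) → A.card ≤ m + e := by
    intro A h s hA
    refine (Finset.card_le_card (t := Finset.univ.image (fun i : Fin m => (h, i)) ∪
      Finset.univ.image (extra s)) fun v hv => ?_).trans ((Finset.card_union_le _ _).trans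
        (add_le_add (Finset.card_image_le.trans (by simp)) (Finset.card_image_le.trans (by simp))))
    rcases hA v hv with rfl | ⟨j, hj⟩
    · exact Finset.mem_union_left _ (Finset.mem_image.mpr ⟨v.2, Finset.mem_univ _, rfl⟩)
    · exact Finset.mem_union_right _ (Finset.mem_image.mpr ⟨j, Finset.mem_univ _, hj⟩)
  let serve : {p : {T : Finset G // T.card = t} × G // p.2 ∉ p.1.1} × Fin l → G × Fin m →
      Option {T : Finset G // T.card = t} := fun s u =>
    if h : u.1 ∈ s.1.1.1.1 then
      some ⟨insert s.1.1.2 (s.1.1.1.1.erase u.1), card_insert_erase s.1.1.1.2 s.1.2 h⟩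
    else if u.1 = s.1.1.2 ∨ ∃ j, extra s j = u then some s.1.1.1 else none
  have hserve_mem : ∀ s u (h : u.1 ∈ s.1.1.1.1), serve s u =
      some ⟨insert s.1.1.2 (s.1.1.1.1.erase u.1), card_insert_erase s.1.1.1.2 s.1.2 h⟩ :=
    fun s u h => dif_pos h
  have hserve_notMem : ∀ s u, u.1 ∉ s.1.1.1.1 → serve s u =
      if u.1 = s.1.1.2 ∨ ∃ j, extra s j = u then some s.1.1.1 else none :=
    fun s u h => dif_neg h
  refine ⟨{
    stored := fun T => T.1 ×ˢ Finset.univ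
    serve := serve
    card_stored := fun T => by simp [T.2]
    card_storing := fun u => ?_
    notMem_stored := fun s u T h => ?_
    card_unaware := fun s u T h => ?_
    delivered := fun u T h => ?_
    balance := ?_ }⟩
  · have := card_subsets_containing t u.1
    simp only [Finset.mem_product, Finset.mem_univ, and_true, Fintype.card_prod, Fintype.card_fin]
    rw [← mul_assoc, this]; ring
  · simp only [Finset.mem_product, Finset.mem_univ, and_true]
    by_cases hu : u.1 ∈ s.1.1.1.1
    · rw [hserve_mem s u hu] at h
      obtain rfl := Option.some_injective _ h
      have := s.1.2
      simp only [Finset.mem_insert, Finset.mem_erase, ne_eq, not_true_eq_false, false_and, or_false]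
      intro h'
      exact this (h' ▸ hu)
    · rw [hserve_notMem s u hu] at h
      split_ifs at h
      obtain rfl := Option.some_injective _ h
      exact hu
  · by_cases hu : u.1 ∈ s.1.1.1.1
    · rw [hserve_mem s u hu] at h
      obtain rfl := Option.some_injective _ h
      refine hunaware _ u.1 s fun v hv => ?_
      simp only [Finset.mem_filter, Finset.mem_univ, true_and, Finset.mem_product, and_true,
        Finset.mem_insert, Finset.mem_erase, not_or, not_and] at hv
      by_cases hv' : v.1 ∈ s.1.1.1.1
      · exact Or.inl (by_contra fun hne => hv.2.2 hne hv')
      · have h1 := hv.1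
        rw [hserve_notMem s v hv'] at h1
        split_ifs at h1 with h2
        · exact Or.inr (h2.resolve_left hv.2.1)
        · simp at h1
    · rw [hserve_notMem s u hu] at h
      split_ifs at h
      obtain rfl := Option.some_injective _ h
      refine hunaware _ s.1.1.2 s fun v hv => ?_
      simp only [Finset.mem_filter, Finset.mem_univ, true_and, Finset.mem_product, and_true] at hv
      have h1 := hv.1
      rw [hserve_notMem s v hv.2] at h1
      split_ifs at h1 with h2
      · exact h2
      · simp at h1
  · obtain ⟨h₀, i⟩ := u
    replace h : h₀ ∉ T.1 := by simpa using h
    have hh₀ : h₀ ∈ T.1ᶜ := by simpa using h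
    have hinv' : ∀ z, inv T z ∉ T.1 := fun z => by simpa using hinv T z
    have hlt : ∀ p : Fin q, p * m + i < l * e := fun p => by
      rw [← hq]
      calc p * m + i < p * m + m := by omega
        _ = (p + 1) * m := by ring
        _ ≤ q * m := Nat.mul_le_mul_right m p.2
    have he0 : ∀ _p : Fin q, 0 < e := fun p => Nat.pos_of_ne_zero fun h0 => by
      have := hlt p
      simp [h0] at this
    -- The `β` transmissions giving class `T` to `(h₀, i)`: `l` with `h₀` as the added group, `l`
    -- for each group of `T` exchanged with `h₀`, and `q` as an extra user, in slots `p * m + i`,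
    -- where `g` is found by shifting back from `h₀`.
    let f : Fin l ⊕ ({g // g ∈ T.1} × Fin l) ⊕ Fin q →
        {p : {T : Finset G // T.card = t} × G // p.2 ∉ p.1.1} × Fin l :=
      Sum.elim (fun a => (⟨(T, h₀), h⟩, a)) (Sum.elim
        (fun y => (⟨(⟨insert h₀ (T.1.erase y.1), card_insert_erase T.2 h y.1.2⟩, y.1.1), by
          simp only [Finset.mem_insert, Finset.mem_erase, ne_eq, not_true_eq_false, false_and,
            or_false]
          intro h'
          exact h (h' ▸ y.1.2)⟩, y.2))
        (fun p => (⟨(T, inv T (pos T h₀ - (((p * m + i) % e / m + 1 : ℕ) : ZMod n))), hinv' _⟩,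
          ⟨(p * m + i) / e, (Nat.div_lt_iff_lt_mul (he0 p)).mpr (hlt p)⟩)))
    have hne : ∀ p : Fin q,
        inv T (pos T h₀ - (((p * m + i) % e / m + 1 : ℕ) : ZMod n)) ≠ h₀ := fun p h' => by
      have h1 := congrArg (pos T) h'
      rw [hpos, sub_eq_self] at h1
      exact natCast_ne_zero_of_pos_of_lt (Nat.succ_pos _) (hshift _ (Nat.mod_lt _ (he0 p))) h1
    have hf : Function.Injective f := by
      rintro (a | y | p) (a' | y' | p') hff
      · simpa [f] using hff
      · simp only [f, Sum.elim_inl, Sum.elim_inr, Prod.mk.injEq, Subtype.mk.injEq] at hff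
        exact absurd (hff.1.2 ▸ y'.1.2) h
      · simp only [f, Sum.elim_inl, Sum.elim_inr, Prod.mk.injEq, Subtype.mk.injEq] at hff
        exact absurd hff.1.2.symm (hne p')
      · simp only [f, Sum.elim_inl, Sum.elim_inr, Prod.mk.injEq, Subtype.mk.injEq] at hff
        exact absurd (hff.1.2 ▸ y.1.2) h
      · simp only [f, Sum.elim_inl, Sum.elim_inr, Prod.mk.injEq, Subtype.mk.injEq] at hff
        congr 2
        exact Prod.ext (Subtype.ext hff.1.2) hff.2
      · simp only [f, Sum.elim_inl, Sum.elim_inr, Prod.mk.injEq, Subtype.mk.injEq] at hff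
        exact absurd (hff.1.2 ▸ y.1.2) (hinv' _)
      · simp only [f, Sum.elim_inl, Sum.elim_inr, Prod.mk.injEq, Subtype.mk.injEq] at hff
        exact absurd hff.1.2 (hne p)
      · simp only [f, Sum.elim_inl, Sum.elim_inr, Prod.mk.injEq, Subtype.mk.injEq] at hff
        exact absurd (hff.1.2 ▸ y'.1.2) (hinv' _)
      · simp only [f, Sum.elim_inr, Prod.mk.injEq, Subtype.mk.injEq, true_and, Fin.mk.injEq] at hff
        have h1 := congrArg (pos T) hff.1
        rw [hpos, hpos] at h1
        have h2 := natCast_inj_of_lt (hshift _ (Nat.mod_lt _ (he0 p)))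
          (hshift _ (Nat.mod_lt _ (he0 p'))) (sub_right_injective h1)
        congr 2
        exact Fin.ext (eq_of_div_eq_of_mod_div_eq hff.2 (by omega) hm)
    have hfserve : ∀ y, serve (f y) (h₀, i) = some T := by
      rintro (a | y | p)
      · rw [hserve_notMem _ _ h]
        exact if_pos (Or.inl rfl)
      · rw [hserve_mem _ _ (Finset.mem_insert_self _ _)]
        exact congrArg some (Subtype.ext (insert_erase_insert_erase y.1.2 h))
      · rw [hserve_notMem _ _ h]
        refine if_pos (Or.inr ⟨⟨(p * m + i) % e, Nat.mod_lt _ (he0 p)⟩, Prod.ext ?_ (Fin.ext ?_)⟩)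
        · simp only [f, extra, Sum.elim_inr, hpos, sub_add_cancel, hinvpos T h₀ hh₀]
        · simp only [f, extra, Sum.elim_inr]
          rw [mul_comm ((p * m + i) / e), Nat.div_add_mod, Nat.mul_add_mod_self_right,
            Nat.mod_eq_of_lt i.2]
    have hcard : Fintype.card (Fin l ⊕ ({g // g ∈ T.1} × Fin l) ⊕ Fin q) = l * (t + 1) + q := by
      simp [T.2]; ring
    rw [← hcard, ← Finset.card_univ]
    exact Finset.card_le_card_of_injOn f (fun y _ => by simp [hfserve]) hf.injOn
  · rw [Fintype.card_prod, Fintype.card_prod, card_subset_notMem, Fintype.card_fin, Fintype.card_fin,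
      ← Nat.sub_mul]
    -- Both sides count the packets delivered over the `l` rounds of one pair `(T, g)`.
    have : l * (t * m + (m + e)) = (l * (t + 1) + q) * m := by
      rw [add_mul, hq]; ring
    rw [mul_assoc _ l, this]
    ring

end DeliveryDesign

end MIR

/-! ### The three subpacketizations -/

theorem theorem2 (K t L N : ℕ) (M : ℝ) (hK : 0 < K) (ht : 0 < t) (hL : 0 < L) (hN : 0 < N)
    (hM : (t : ℝ) = K * M / N) (htL : t + L ≤ K) (hLt : L ≤ t) :
    (∀ m : ℕ, 0 < m → m ∣ K → m ∣ t → m ≤ L → t + L < K →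
      ∃ F : ℕ, (F : ℚ) = MIR.beta t L m * (Nat.choose (K / m) (t / m) : ℚ) ∧
        MIR.Achievable L K N F M (K * (1 - M / N) / (t + L)) (t + L)) ∧
    (∀ α : ℕ, α = Nat.gcd K (Nat.gcd t L) →
      MIR.Achievable L K N ((t + L) / α * Nat.choose (K / α) ((t + L) / α)) M
        (K * (1 - M / N) / (t + L)) (t + L)) ∧
    (L = K - t →
      MIR.Achievable L K N K M (K * (1 - M / N) / (t + L)) (t + L)) := by
  refine ⟨fun m hm hmK hmt hmL _ => ?_, fun α hα => ?_, fun hLK => ?_⟩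
  · obtain ⟨K', rfl⟩ := hmK
    obtain ⟨t', rfl⟩ := hmt
    rw [Nat.mul_div_cancel_left _ hm, Nat.mul_div_cancel_left _ hm]
    have htK : t' < K' := by
      by_contra h
      have := Nat.mul_le_mul_left m (not_lt.mp h)
      omega
    have hmQ : (m : ℚ) ≠ 0 := by positivity
    have hX : Fintype.card {T : Finset (Fin K') // T.card = t'} = K'.choose t' := by simp
    have hX0 : 0 < Fintype.card {T : Finset (Fin K') // T.card = t'} := by
      rw [hX]; exact Nat.choose_pos htK.le
    have hU : Fintype.card (Fin K' × Fin m) = m * K' := by simp [mul_comm]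
    -- For `m = L` there are no extra users, `l = m / gcd(m, 0) = 1` and `β = 1`: the lifted subset
    -- design saves the factor `t/m + 1` of the grouped one.
    rcases hmL.eq_or_lt with rfl | hmL
    · refine ⟨K'.choose t', ?_, ?_⟩
      · simp [MIR.beta, MIR.sgn, MIR.ell, hmQ, hm]
      · let D := (MIR.DeliveryDesign.ofSubsets (Fin K') t').lift m
        rw [mul_comm t' m, one_mul] at D
        rw [← hX, ← mul_one (Fintype.card _)]
        exact D.achievable hU one_pos hX0 hN hL hM htL hLt
    · obtain ⟨e, rfl⟩ := Nat.exists_eq_add_of_le hmL.le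
      have hg : 0 < Nat.gcd m e := Nat.gcd_pos_of_pos_left _ hm
      -- With `e = L - m`, dividing `m` and `e` by their gcd gives the `l` and `q` for which the
      -- extra slots are shared evenly; then `q = (e / m) * l`, the last term of `β`.
      obtain ⟨l, hl⟩ := Nat.gcd_dvd_left m e
      obtain ⟨q, hq⟩ := Nat.gcd_dvd_right m e
      have hql : q * m = l * e := by
        conv_lhs => rw [hl]
        conv_rhs => rw [hq]
        ring
      have hell : MIR.ell (m + e) m = l := by
        rw [MIR.ell, Nat.add_sub_cancel_left]
        exact Nat.div_eq_of_eq_mul_right hg hl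
      have hl0 : 0 < l := Nat.pos_of_ne_zero fun h => by simp [h] at hl; omega
      obtain ⟨D⟩ := MIR.DeliveryDesign.nonempty_grouped (Fin K') (t := t') hm (by simpa using htK) hql
        (by
          rw [Fintype.card_fin, Nat.sub_mul, mul_comm K', mul_comm t']
          omega)
      rw [mul_comm t' m] at D
      have hβ : 0 < l * (t' + 1) + q := by positivity
      refine ⟨Fintype.card {T : Finset (Fin K') // T.card = t'} * (l * (t' + 1) + q), ?_,
        D.achievable hU hβ hX0 hN hL hM htL hLt⟩
      have hsgn : (m : ℚ) / ((m + e : ℕ) : ℚ) ≠ 1 := by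
        have h0 : ((m + e : ℕ) : ℚ) ≠ 0 := by positivity
        rw [Ne, div_eq_one_iff_eq h0]
        exact_mod_cast hmL.ne
      have hqlQ : (q : ℚ) * m = l * e := by exact_mod_cast hql
      rw [hX, MIR.beta, hell, MIR.sgn, if_neg hsgn]
      push_cast
      rw [mul_div_cancel_left₀ _ hmQ, add_sub_cancel_left]
      have : (q : ℚ) = e / m * l := by
        field_simp
        linear_combination hqlQ
      rw [this]; ring
  · have hα0 : 0 < α := hα ▸ Nat.gcd_pos_of_pos_left _ hK
    obtain ⟨K', hK'⟩ : α ∣ K := hα ▸ Nat.gcd_dvd_left _ _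
    obtain ⟨t', ht'⟩ : α ∣ t := hα ▸ (Nat.gcd_dvd_right _ _).trans (Nat.gcd_dvd_left _ _)
    obtain ⟨L', hL'⟩ : α ∣ L := hα ▸ (Nat.gcd_dvd_right _ _).trans (Nat.gcd_dvd_right _ _)
    clear hα
    subst hK' ht' hL'
    have hL0 : 0 < L' := Nat.pos_of_mul_pos_left hL
    have htL' : t' + L' ≤ K' := by
      rw [← mul_add] at htL
      exact Nat.le_of_mul_le_mul_left htL hα0
    have : NeZero (t' + L') := ⟨by omega⟩
    obtain ⟨D⟩ := MIR.DeliveryDesign.nonempty_cyclic (Fin K') hL0 (by simpa using htL')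
    let D' := D.lift α
    rw [mul_comm t' α, mul_comm L' α] at D'
    have hX : Fintype.card ({Q : Finset (Fin K') // Q.card = t' + L'} × ZMod (t' + L')) * 1 =
        (α * t' + α * L') / α * Nat.choose (α * K' / α) ((α * t' + α * L') / α) := by
      rw [← mul_add, Nat.mul_div_cancel_left _ hα0, Nat.mul_div_cancel_left _ hα0]
      simp [mul_comm]
    rw [← hX]
    refine D'.achievable (by simp [mul_comm]) one_pos ?_ hN hL hM htL hLt
    rw [← mul_one (Fintype.card _), hX, ← mul_add, Nat.mul_div_cancel_left _ hα0,
      Nat.mul_div_cancel_left _ hα0]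
    exact Nat.mul_pos (by omega) (Nat.choose_pos htL')
  · have hKtL : t + L = K := by omega
    have : NeZero (t + L) := ⟨by omega⟩
    obtain ⟨D⟩ := MIR.DeliveryDesign.nonempty_cyclic (Fin K) hL (by simpa using htL)
    -- Only the full set has `t + L = K` elements, so just the `K` choices of distinguished element
    -- remain.
    have hX : Fintype.card ({Q : Finset (Fin K) // Q.card = t + L} × ZMod (t + L)) * 1 = K := by
      simp [hKtL]
    have := D.achievable (Fintype.card_fin K) one_pos (by omega) hN hL hM htL hLt
    rwa [hX] at this
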